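/- Let $X$ be a connected finite simplicial complex (of any dimension) endowed with a piecewise flat metric: every simplex carries the metric of a nondegenerate Euclidean simplex, so that the metric of each face of a simplex is the restriction of the metric of the simplex. Give $X$ the induced length metric, and let $\mathrm{sys}(X)\in[0,\infty]$ be the infimum of the lengths of the noncontractible loops of $X$ ($\mathrm{sys}(X)=\infty$ if $X$ is simply connected). Suppose that $X$ is covered by $m$ open balls $B_1,\dots,B_m$ of radius $R=\frac16\,\mathrm{sys}(X)$, and let $\mathcal N$ be the nerve of this covering, that is, the simplicial complex with vertices $p_1,\dots,p_m$ in which $p_{i_0},\dots,p_{i_k}$ span a simplex if and only if $B_{i_0}\cap\dots\cap B_{i_k}\neq\emptyset$. Then $\mathcal N$ is connected and the fundamental groups of $X$ and $\mathcal N$ are isomorphic. Consequently $\pi_1(X)\in\Gamma(m)$, where $\Gamma(n)$ denotes the set of isomorphism classes of fundamental groups of connected finite simplicial complexes of dimension at most $2$ with at most $n$ vertices. -/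

import Mathlib

open scoped ENNReal

noncomputable section

namespace SystolicNerve

universe u

/-! ### Finite simplicial complexes and their geometric realizations -/

/-- The geometric realization of a simplicial complex `K` with finitely many vertices: the points
are the systems of barycentric coordinates `x : V → ℝ` (nonnegative, of sum `1`) whose support is
a simplex of `K`. -/
def Realization {V : Type u} [Fintype V] (K : PreAbstractSimplicialComplex V) : Type u :=
  {x : V → ℝ // x ∈ stdSimplex ℝ V ∧ ∃ s ∈ K.faces, ∀ v, v ∈ s ↔ x v ≠ 0}

/-- The topology of the realization of a finite complex is that of a subspace of `ℝ^V`. -/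
instance {V : Type u} [Fintype V] (K : PreAbstractSimplicialComplex V) :
    TopologicalSpace (Realization K) :=
  instTopologicalSpaceSubtype

/-- The closed simplex of the realization spanned by the face `s`. -/
def closedSimplex {V : Type u} [Fintype V] (K : PreAbstractSimplicialComplex V) (s : Finset V) :
    Set (Realization K) :=
  {x | ∀ v, x.1 v ≠ 0 → v ∈ s}

/-- The nerve of a family of sets: a nonempty finite set of indices is a simplex if and only if
the corresponding members of the family have a common point. -/
def nerve {X ι : Type*} (B : ι → Set X) : PreAbstractSimplicialComplex ι where
  faces := {s | s.Nonempty ∧ ∃ x, ∀ i ∈ s, x ∈ B i}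
  isRelLowerSet_faces := fun _ hs =>
    ⟨hs.1, fun _ hts ht => ⟨ht, hs.2.imp fun _ hx i hi => hx i (hts hi)⟩⟩

/-- `MemGamma n G`: the isomorphism class of the group `G` belongs to `Γ(n)`, that is, `G` is
isomorphic to the fundamental group of a connected finite simplicial complex of dimension at most
two with at most `n` vertices. -/
def MemGamma (n : ℕ) (G : Type u) [Group G] : Prop :=
  ∃ k ≤ n, ∃ K : AbstractSimplicialComplex (Fin k),
    (∀ s ∈ K.faces, s.card ≤ 3) ∧
    PathConnectedSpace (Realization K.toPreAbstractSimplicialComplex) ∧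
    ∃ p : Realization K.toPreAbstractSimplicialComplex, Nonempty (G ≃* FundamentalGroup _ p)

/-! ### Piecewise flat metrics -/

/-- A piecewise flat metric on a finite simplicial complex: every simplex `s` is identified
affinely with a nondegenerate Euclidean simplex, with vertices `pos s v` for `v ∈ s`, in such a
way that the identification of a face of `s` is isometric to the one induced from `s`
(a Euclidean simplex is determined up to isometry by the distances between its vertices).
The values `pos s v` for `s` not a face or `v ∉ s` play no role. -/
structure PiecewiseFlatMetric {V : Type u} [Fintype V] (K : PreAbstractSimplicialComplex V) where
  pos : Finset V → V → EuclideanSpace ℝ V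
  affineIndependent : ∀ s ∈ K.faces, AffineIndependent ℝ (fun v : s => pos s v)
  dist_pos : ∀ s ∈ K.faces, ∀ t ∈ K.faces, t ⊆ s → ∀ v ∈ t, ∀ w ∈ t,
    dist (pos t v) (pos t w) = dist (pos s v) (pos s w)

namespace PiecewiseFlatMetric

variable {V : Type u} [Fintype V] {K : PreAbstractSimplicialComplex V}

/-- The affine identification of the closed simplex `s` with a Euclidean simplex. -/
def chart (G : PiecewiseFlatMetric K) (s : Finset V) (x : Realization K) : EuclideanSpace ℝ V :=
  ∑ v ∈ s, x.1 v • G.pos s v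

/-- The Euclidean distance between two points of a common closed simplex (it does not depend on
the simplex); it is `∞` if there is no such simplex. -/
def simplexDist (G : PiecewiseFlatMetric K) (x y : Realization K) : ℝ≥0∞ :=
  ⨅ s ∈ {s | s ∈ K.faces ∧ x ∈ closedSimplex K s ∧ y ∈ closedSimplex K s},
    edist (G.chart s x) (G.chart s y)

/-- The intrinsic distance: the infimum of the lengths of the broken lines
`x = z 0, z 1, …, z n = y` such that any two consecutive points lie in a common simplex. -/
def intrinsicDist (G : PiecewiseFlatMetric K) (x y : Realization K) : ℝ≥0∞ :=
  ⨅ (n : ℕ) (z : ℕ → Realization K) (_ : z 0 = x) (_ : z n = y),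
    ∑ i ∈ Finset.range n, G.simplexDist (z i) (z (i + 1))

theorem simplexDist_comm (G : PiecewiseFlatMetric K) (x y : Realization K) :
    G.simplexDist x y = G.simplexDist y x := by
  have h : ∀ a b, G.simplexDist a b ≤ G.simplexDist b a := by
    intro a b
    refine le_iInf₂ fun s hs => ?_
    rw [edist_comm]
    exact iInf₂_le s ⟨hs.1, hs.2.2, hs.2.1⟩
  exact le_antisymm (h x y) (h y x)

theorem intrinsicDist_le (G : PiecewiseFlatMetric K) (n : ℕ) (z : ℕ → Realization K) :
    G.intrinsicDist (z 0) (z n) ≤ ∑ i ∈ Finset.range n, G.simplexDist (z i) (z (i + 1)) :=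
  iInf₂_le_of_le n z <| iInf₂_le_of_le rfl rfl le_rfl

theorem intrinsicDist_self (G : PiecewiseFlatMetric K) (x : Realization K) :
    G.intrinsicDist x x = 0 := by
  simpa using G.intrinsicDist_le 0 (fun _ => x)

theorem intrinsicDist_comm (G : PiecewiseFlatMetric K) (x y : Realization K) :
    G.intrinsicDist x y = G.intrinsicDist y x := by
  have h : ∀ a b, G.intrinsicDist a b ≤ G.intrinsicDist b a := by
    intro a b
    refine le_iInf₂ fun n z => le_iInf₂ fun h0 hn => ?_
    have := G.intrinsicDist_le n (fun i => z (n - i))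
    simp only [Nat.sub_zero, Nat.sub_self, h0, hn] at this
    refine this.trans (le_of_eq ?_)
    rw [← Finset.sum_range_reflect]
    refine Finset.sum_congr rfl fun i hi => ?_
    have hi := Finset.mem_range.1 hi
    rw [G.simplexDist_comm, show n - (n - 1 - i + 1) = i by omega,
      show n - (n - 1 - i) = i + 1 by omega]
  exact le_antisymm (h x y) (h y x)

theorem intrinsicDist_triangle (G : PiecewiseFlatMetric K) (x y w : Realization K) :
    G.intrinsicDist x w ≤ G.intrinsicDist x y + G.intrinsicDist y w := by
  conv_rhs => unfold intrinsicDist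
  simp only [ENNReal.iInf_add, ENNReal.add_iInf]
  refine le_iInf₂ fun k z' => le_iInf₂ fun h0' hk => le_iInf₂ fun n z => le_iInf₂ fun h0 hn => ?_
  have := G.intrinsicDist_le (n + k) (fun i => if i ≤ n then z i else z' (i - n))
  have e : (if n + k ≤ n then z (n + k) else z' (n + k - n)) = w := by
    split_ifs with h
    · obtain rfl : k = 0 := by omega
      rw [add_zero, hn, ← h0', hk]
    · rw [Nat.add_sub_cancel_left, hk]
  simp only [Nat.zero_le, if_true, e, h0] at this
  refine this.trans (le_of_eq ?_)
  rw [Finset.sum_range_add]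
  congr 1
  · refine Finset.sum_congr rfl fun i hi => ?_
    have hi := Finset.mem_range.1 hi
    rw [if_pos (by omega), if_pos (by omega)]
  · refine Finset.sum_congr rfl fun i _ => ?_
    rw [if_neg (by omega : ¬ n + i + 1 ≤ n), show n + i + 1 - n = i + 1 by omega]
    split_ifs with h
    · obtain rfl : i = 0 := by omega
      rw [add_zero, hn, h0']
    · rw [Nat.add_sub_cancel_left]

/-- The realization with the intrinsic distance of a piecewise flat metric. -/
abbrev toPseudoEMetricSpace (G : PiecewiseFlatMetric K) : PseudoEMetricSpace (Realization K) where
  edist := G.intrinsicDist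
  edist_self := G.intrinsicDist_self
  edist_comm := G.intrinsicDist_comm
  edist_triangle := G.intrinsicDist_triangle

/-- The open ball of centre `c` and radius `r`. -/
def openBall (G : PiecewiseFlatMetric K) (c : Realization K) (r : ℝ≥0∞) : Set (Realization K) :=
  {y | G.intrinsicDist c y < r}

/-- The length of a path: the supremum over all subdivisions of the sums of the distances between
consecutive points. -/
def length (G : PiecewiseFlatMetric K) {x y : Realization K} (γ : Path x y) : ℝ≥0∞ :=
  letI := G.toPseudoEMetricSpace
  eVariationOn (γ : unitInterval → Realization K) Set.univ

/-- The systole: the infimum of the lengths of the noncontractible loops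
(it is `∞` if every loop is contractible). -/
def systole (G : PiecewiseFlatMetric K) : ℝ≥0∞ :=
  ⨅ (x : Realization K) (γ : Path x x) (_ : ¬ γ.Homotopic (Path.refl x)), G.length γ

end PiecewiseFlatMetric

end SystolicNerve

end

/-! Put $R=\mathrm{sys}(X)/6$. Loops shorter than the systole are contractible, so two paths with
common endpoints and total length below $4R\le\mathrm{sys}(X)$ are homotopic. Subdividing a path
inside a ball shows that it is homotopic to a path through the centre made of two pieces shorter
than $R$ (`pathHom_comp_of_mem_openBall`); hence paths with the same endpoints, each in some ball of
the cover, are homotopic. Intersections of balls may be disconnected, but this condition on pairs of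
balls, called `IsGoodCover`, is enough to control $\pi_1$.

A good cover determines $\pi_1$ through its nonempty triple intersections. Joining the base point to
the members of the cover yields a tautological cocycle with values in $\pi_1(X)$. Any cocycle with
values in a group $G$ is, up to a coboundary, its image under a homomorphism $\pi_1(X)\to G$, the
monodromy of the covering space glued from that cocycle; and an endomorphism of $\pi_1(X)$ that
changes the tautological cocycle only by a coboundary is inner (`exists_cocycle`). Covers with the
same triple intersections have the same cocycles, so their groups are isomorphic
(`nonempty_mulEquiv`).

The open vertex stars of the nerve, or of its 2-skeleton, form a good cover with the same triple
intersections as the balls (`isGoodCover_vertexStar`). -/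

namespace SystolicNerve

open CategoryTheory Set unitInterval

/-! ### Paths and open covers -/

section PathHom

variable {X : Type*} [TopologicalSpace X]

/-- The homotopy class of a path, as a morphism of the fundamental groupoid. -/
def pathHom {x y : X} (γ : Path x y) : FundamentalGroupoid.mk x ⟶ FundamentalGroupoid.mk y :=
  Path.Homotopic.Quotient.mk γ

theorem pathHom_eq_iff {x y : X} {γ δ : Path x y} : pathHom γ = pathHom δ ↔ γ.Homotopic δ :=
  Path.Homotopic.Quotient.eq

theorem pathHom_trans {x y z : X} (γ : Path x y) (δ : Path y z) :
    pathHom (γ.trans δ) = pathHom γ ≫ pathHom δ := rfl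

theorem pathHom_refl (x : X) : pathHom (Path.refl x) = 𝟙 (FundamentalGroupoid.mk x) := rfl

theorem pathHom_symm {x y : X} (γ : Path x y) : pathHom γ.symm = Groupoid.inv (pathHom γ) := rfl

theorem pathHom_surjective {x y : X}
    (f : FundamentalGroupoid.mk x ⟶ FundamentalGroupoid.mk y) : ∃ γ : Path x y, pathHom γ = f :=
  Path.Homotopic.Quotient.mk_surjective f

/-- A property of homotopy classes of paths that is stable under concatenation and holds for the
paths subordinate to an open cover of `S` holds for all paths in `S`. -/
theorem pathHom_induction {κ : Type*} {S : Set X} {W : κ → Set X} (hW : ∀ k, IsOpen (W k))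
    (hS : S ⊆ ⋃ k, W k)
    {P : ∀ x y : X, (FundamentalGroupoid.mk x ⟶ FundamentalGroupoid.mk y) → Prop}
    (small : ∀ k (x y : X) (γ : Path x y), (∀ t, γ t ∈ S) → (∀ t, γ t ∈ W k) → P x y (pathHom γ))
    (trans : ∀ x y z f g, y ∈ S → P x y f → P y z g → P x z (f ≫ g))
    {x y : X} (γ : Path x y) (hγ : ∀ t, γ t ∈ S) : P x y (pathHom γ) := by
  obtain ⟨t, t0, tm, ⟨n, hn⟩, ht⟩ := exists_monotone_Icc_subset_open_cover_unitInterval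
    (c := fun k => γ ⁻¹' W k) (fun k => (hW k).preimage γ.continuous)
    (fun s _ => by simpa using hS (hγ s))
  have piece : ∀ m, P _ _ (pathHom (γ.subpath (t m) (t (m + 1)))) := by
    intro m
    obtain ⟨k, hk⟩ := ht m
    refine small k _ _ _ (fun s => hγ _) fun s => ?_
    have : γ.subpath (t m) (t (m + 1)) s ∈ range (γ.subpath (t m) (t (m + 1))) := ⟨s, rfl⟩
    rw [Path.range_subpath_of_le _ _ _ (tm m.le_succ)] at this
    obtain ⟨r, hr, hr'⟩ := this
    rw [← hr']
    exact hk hr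
  -- `P` is not assumed for constant paths, so the induction starts with one piece and ends at `t (n
  -- + 1) = 1`.
  have main : ∀ m, P _ _ (pathHom (γ.subpath (t 0) (t (m + 1)))) := by
    intro m
    induction m with
    | zero => exact piece 0
    | succ m ih =>
      have := trans _ _ _ _ _ (hγ _) ih (piece (m + 1))
      rw [← pathHom_trans, pathHom_eq_iff.2 ⟨Path.Homotopy.subpathTransSubpath γ _ _ _⟩] at this
      exact this
  have := main n
  rw [t0, hn (n + 1) n.le_succ, Path.subpath_zero_one] at this
  have key : ∀ {x' y' : X} (hx : x' = x) (hy : y' = y), P x' y' (pathHom (γ.cast hx hy)) →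
      P x y (pathHom γ) := by
    rintro _ _ rfl rfl h
    exact h
  exact key _ _ this

end PathHom

/-! ### Monodromy of a cocycle -/

section Cocycle

variable {X ι G : Type*} [Group G]

/-- A family of elements of a group, indexed by the pairs of members of a cover, that satisfies
the cocycle condition on nonempty triple intersections. -/
def IsCocycle (U : ι → Set X) (e : ι → ι → G) : Prop :=
  ∀ i j k, (U i ∩ U j ∩ U k).Nonempty → e j k * e i j = e i k

theorem IsCocycle.self {U : ι → Set X} {e : ι → ι → G} (he : IsCocycle U e) {i : ι} {x : X}
    (hx : x ∈ U i) : e i i = 1 := by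
  simpa using he i i i ⟨x, ⟨hx, hx⟩, hx⟩

variable [TopologicalSpace X]

/-- The covering space associated with a cocycle. -/
def IsCocycle.bundleCore [TopologicalSpace G] [DiscreteTopology G] {U : ι → Set X}
    {e : ι → ι → G} (he : IsCocycle U e)
    (hU : ∀ i, IsOpen (U i)) (idx : X → ι) (hidx : ∀ x, x ∈ U (idx x)) :
    FiberBundleCore ι X G where
  baseSet := U
  isOpen_baseSet := hU
  indexAt := idx
  mem_baseSet_at := hidx
  coordChange i j _ g := e i j * g
  coordChange_self i x hx g := by rw [he.self hx, one_mul]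
  continuousOn_coordChange i j :=
    (continuous_of_discreteTopology (f := fun g : G => e i j * g)).comp_continuousOn
      continuousOn_snd
  coordChange_comp i j k x hx g := by rw [← mul_assoc, he i j k ⟨x, hx⟩]

/-- A cocycle is induced by a functor defined on the fundamental groupoid. -/
theorem IsCocycle.exists_functor {U : ι → Set X}
    {e : ι → ι → G} (he : IsCocycle U e) (hU : ∀ i, IsOpen (U i)) (idx : X → ι)
    (hidx : ∀ x, x ∈ U (idx x)) :
    ∃ Φ : ∀ x y : X, (FundamentalGroupoid.mk x ⟶ FundamentalGroupoid.mk y) → G,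
      (∀ x y z f g, Φ x z (f ≫ g) = Φ y z g * Φ x y f) ∧
      ∀ i x y (γ : Path x y), (∀ t, γ t ∈ U i) →
        Φ x y (pathHom γ) = e i (idx y) * e (idx x) i := by
  let _ : TopologicalSpace G := ⊥
  have : DiscreteTopology G := ⟨rfl⟩
  let Z := he.bundleCore hU idx hidx
  have cov : IsCoveringMap Z.proj := FiberBundle.isCoveringMap (F := G) (E := Z.Fiber)
  let fib : ∀ x : X, Z.proj ⁻¹' {x} → G := fun x p => p.1.2
  let pt : ∀ x : X, G → Z.proj ⁻¹' {x} := fun x g => ⟨⟨x, g⟩, rfl⟩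
  have pt_fib : ∀ x p, pt x (fib x p) = p := by
    rintro x ⟨⟨y, g⟩, rfl⟩
    rfl
  let Ψ : ∀ x y : X, (FundamentalGroupoid.mk x ⟶ FundamentalGroupoid.mk y) → G → G :=
    fun x y f g => fib y (cov.monodromy f (pt x g))
  have hΨ : ∀ x y z f g a, Ψ x z (f ≫ g) a = Ψ y z g (Ψ x y f a) := by
    intro x y z f g a
    simp only [Ψ, pt_fib]
    exact congrArg (fib z) (cov.monodromy_trans_apply f g _)
  have small : ∀ i x y (γ : Path x y), (∀ t, γ t ∈ U i) → ∀ g,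
      Ψ x y (pathHom γ) g = e i (idx y) * e (idx x) i * g := by
    intro i x y γ hγ g
    let q := Z.localTriv i
    -- The lift is constant in the trivialization over `U i`; the factors `e` pass between that
    -- chart and the preferred charts at the points.
    let Γ : I → Z.TotalSpace := fun t => ⟨γ t, e i (idx (γ t)) * (e (idx x) i * g)⟩
    have hx : x ∈ U i := by simpa using hγ 0
    have hΓ : Continuous Γ := by
      have h1 : ContinuousOn q.invFun q.target := q.continuousOn_invFun
      have h2 : Continuous fun t => (γ t, e (idx x) i * g) := by fun_prop
      refine h1.comp_continuous h2 fun t => ?_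
      rw [q.target_eq]
      exact ⟨hγ t, trivial⟩
    have h0 : Γ 0 = ⟨x, g⟩ := by
      have : ∀ z, z = x → (⟨z, e i (idx z) * (e (idx x) i * g)⟩ : Z.TotalSpace) = ⟨x, g⟩ := by
        rintro _ rfl
        rw [← mul_assoc, he _ i _ ⟨_, ⟨hidx _, hx⟩, hidx _⟩, he.self (hidx _), one_mul]
      exact this _ γ.source
    have hl := (cov.eq_liftPath_iff (γ := γ.toContinuousMap) (e := ⟨x, g⟩)
      γ.source (Γ := Γ)).2 ⟨hΓ, rfl, h0⟩
    have h1 : Γ 1 = (cov.monodromy (pathHom γ) (pt x g)).1 := congrFun hl 1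
    have : ∀ z (p : Z.proj ⁻¹' {y}), z = y →
        (⟨z, e i (idx z) * (e (idx x) i * g)⟩ : Z.TotalSpace) = p.1 →
        fib y p = e i (idx y) * e (idx x) i * g := by
      rintro _ ⟨p, hp⟩ rfl rfl
      exact (mul_assoc _ _ _).symm
    exact this _ _ γ.target h1
  -- Transition maps are left translations, so monodromy is one too, and its value at `1` determines
  -- it.
  have equi : ∀ x y f, ∃ a, ∀ g, Ψ x y f g = a * g := by
    intro x y f
    obtain ⟨γ, rfl⟩ := pathHom_surjective f
    refine pathHom_induction (S := univ) (P := fun x y f => ∃ a, ∀ g, Ψ x y f g = a * g) hU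
      (fun x _ => mem_iUnion.2 ⟨_, hidx x⟩) (fun i x y γ _ h => ⟨_, small i x y γ h⟩) ?_ γ
      fun _ => trivial
    rintro x y z f g - ⟨a, ha⟩ ⟨b, hb⟩
    exact ⟨b * a, fun c => by rw [hΨ, ha, hb, mul_assoc]⟩
  have equi' : ∀ x y f g, Ψ x y f g = Ψ x y f 1 * g := by
    intro x y f g
    obtain ⟨a, ha⟩ := equi x y f
    rw [ha, ha, mul_one]
  refine ⟨fun x y f => Ψ x y f 1, fun x y z f g => ?_, fun i x y γ h => ?_⟩
  · exact (hΨ x y z f g 1).trans (equi' y z g _)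
  · exact (small i x y γ h 1).trans (mul_one _)

end Cocycle

/-! ### Good covers -/

/-- An open cover by path connected sets such that two paths with the same endpoints are homotopic
in the ambient space as soon as each of them lies in a member of the cover. -/
structure IsGoodCover {X ι : Type*} [TopologicalSpace X] (U : ι → Set X) : Prop where
  isOpen : ∀ i, IsOpen (U i)
  exists_mem : ∀ x, ∃ i, x ∈ U i
  isPathConnected : ∀ i, IsPathConnected (U i)
  homotopic : ∀ i j (x y : X) (α β : Path x y), (∀ t, α t ∈ U i) → (∀ t, β t ∈ U j) →
    α.Homotopic β

namespace IsGoodCover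

variable {X ι : Type*} [TopologicalSpace X] {U : ι → Set X}

/-- For `x ∈ U i`, go from `x₀` to a chosen point of `U i`, then to `x` inside `U i`; the second leg
is unique up to homotopy. Outside `U i` the value is arbitrary. -/
theorem exists_tether [PathConnectedSpace X] (hU : IsGoodCover U) (x₀ : X) :
    ∃ τ : ι → ∀ x : X, FundamentalGroupoid.mk x₀ ⟶ FundamentalGroupoid.mk x,
      ∀ i x y (γ : Path x y), (∀ t, γ t ∈ U i) → τ i x ≫ pathHom γ = τ i y := by
  classical
  choose c hc hσ using hU.isPathConnected
  choose p hp using fun i x (hx : x ∈ U i) => hσ i hx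
  refine ⟨fun i x => if hx : x ∈ U i then
      pathHom (PathConnectedSpace.somePath x₀ (c i)) ≫ pathHom (p i x hx)
    else pathHom (PathConnectedSpace.somePath x₀ x), fun i x y γ hγ => ?_⟩
  have hx : x ∈ U i := by simpa using hγ 0
  have hy : y ∈ U i := by simpa using hγ 1
  have hom : ((p i x hx).trans γ).Homotopic (p i y hy) := by
    refine hU.homotopic i i _ _ _ _ (fun t => ?_) (hp i y hy)
    have : (p i x hx).trans γ t ∈ range (p i x hx) ∪ range γ := by
      rw [← Path.trans_range]
      exact ⟨t, rfl⟩
    rcases this with ⟨s, hs⟩ | ⟨s, hs⟩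
    · exact hs ▸ hp i x hx s
    · exact hs ▸ hγ s
  simp only [dif_pos hx, dif_pos hy]
  rw [Category.assoc, ← pathHom_trans (p i x hx), pathHom_eq_iff.2 hom]

/-- Since `U i ∩ U j` may be disconnected, `x` and `y` are joined once in `U i` and once in `U j`;
the homotopy condition on pairs identifies the two paths. This makes the tautological cocycle
independent of the chosen point. -/
theorem tether_comp_inv (hU : IsGoodCover U) {x₀ : X}
    {τ : ι → ∀ x : X, FundamentalGroupoid.mk x₀ ⟶ FundamentalGroupoid.mk x}
    (hτ : ∀ i x y (γ : Path x y), (∀ t, γ t ∈ U i) → τ i x ≫ pathHom γ = τ i y)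
    {i j : ι} {x y : X} (hx : x ∈ U i ∩ U j) (hy : y ∈ U i ∩ U j) :
    τ i x ≫ inv (τ j x) = τ i y ≫ inv (τ j y) := by
  obtain ⟨α, hα⟩ := (hU.isPathConnected i).joinedIn _ hx.1 _ hy.1
  obtain ⟨β, hβ⟩ := (hU.isPathConnected j).joinedIn _ hx.2 _ hy.2
  rw [← hτ i x y α hα, ← hτ j x y β hβ, pathHom_eq_iff.2 (hU.homotopic i j x y α β hα hβ)]
  simp

universe v

/-- The tautological cocycle of a good cover and its universal property. -/
theorem exists_cocycle [PathConnectedSpace X] (hU : IsGoodCover U) (x₀ : X) :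
    ∃ e : ι → ι → FundamentalGroup X x₀, IsCocycle U e ∧
      (∀ (F : FundamentalGroup X x₀ →* FundamentalGroup X x₀) (a : ι → FundamentalGroup X x₀),
        (∀ i j, (U i ∩ U j).Nonempty → F (e i j) = a j * e i j * (a i)⁻¹) →
        Function.Bijective F) ∧
      ∀ (G : Type v) [Group G] (e' : ι → ι → G), IsCocycle U e' →
        ∃ (F : FundamentalGroup X x₀ →* G) (a : ι → G), ∀ i j, (U i ∩ U j).Nonempty →
          F (e i j) = a j * e' i j * (a i)⁻¹ := by
  classical
  obtain ⟨τ, hτ⟩ := hU.exists_tether x₀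
  choose idx hidx using hU.exists_mem
  let e : ι → ι → FundamentalGroup X x₀ := fun i j =>
    if h : (U i ∩ U j).Nonempty then τ i h.some ≫ inv (τ j h.some) else 1
  have he : ∀ i j x, x ∈ U i ∩ U j → e i j = FundamentalGroup.fromArrow (τ i x ≫ inv (τ j x)) := by
    intro i j x hx
    have h : (U i ∩ U j).Nonempty := ⟨x, hx⟩
    simp only [e, dif_pos h]
    exact hU.tether_comp_inv hτ h.some_mem hx
  refine ⟨e, ?_, ?_, ?_⟩
  · rintro i j k ⟨x, ⟨hi, hj⟩, hk⟩
    rw [he i j x ⟨hi, hj⟩, he j k x ⟨hj, hk⟩, he i k x ⟨hi, hk⟩, End.mul_def]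
    simp
  · intro F a hF
    -- The twisting rule for `e` extends to all tethered morphisms: it is stable under subdivision,
    -- and a path in `U k` contributes `e k j * e i k`.
    have key : ∀ x y f, ∀ i j, x ∈ U i → y ∈ U j →
        F (FundamentalGroup.fromArrow (τ i x ≫ f ≫ inv (τ j y))) =
          a j * FundamentalGroup.fromArrow (τ i x ≫ f ≫ inv (τ j y)) * (a i)⁻¹ := by
      intro x y f
      obtain ⟨γ, rfl⟩ := pathHom_surjective f
      refine pathHom_induction (S := univ) (P := fun x y f => ∀ i j, x ∈ U i → y ∈ U j →
        F (FundamentalGroup.fromArrow (τ i x ≫ f ≫ inv (τ j y))) =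
          a j * FundamentalGroup.fromArrow (τ i x ≫ f ≫ inv (τ j y)) * (a i)⁻¹) hU.isOpen
        (fun x _ => mem_iUnion.2 ⟨_, hidx x⟩) ?_ ?_ γ fun _ => trivial
      · intro k x y γ _ hγ i j hx hy
        have hxk : x ∈ U k := by simpa using hγ 0
        have hyk : y ∈ U k := by simpa using hγ 1
        have : FundamentalGroup.fromArrow (τ i x ≫ pathHom γ ≫ inv (τ j y)) = e k j * e i k := by
          rw [he i k x ⟨hx, hxk⟩, he k j y ⟨hyk, hy⟩, End.mul_def, ← hτ k x y γ hγ]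
          simp
        rw [this, map_mul, hF _ _ ⟨x, hx, hxk⟩, hF _ _ ⟨y, hyk, hy⟩]
        group
      · intro x y z f g _ hf hg i j hx hz
        have : FundamentalGroup.fromArrow (τ i x ≫ (f ≫ g) ≫ inv (τ j z)) =
            FundamentalGroup.fromArrow (τ (idx y) y ≫ g ≫ inv (τ j z)) *
              FundamentalGroup.fromArrow (τ i x ≫ f ≫ inv (τ (idx y) y)) := by
          rw [End.mul_def]
          simp
        rw [this, map_mul, hf _ _ hx (hidx y), hg _ _ (hidx y) hz]
        group
    let τ₀ : FundamentalGroup X x₀ := τ (idx x₀) x₀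
    let a₀ := a (idx x₀)
    -- At the base point `key` determines `F` on `τ₀⁻¹ * f * τ₀`; solving for `F f` exhibits `F` as
    -- inner.
    have conj : ∀ f, F f = (F τ₀ * a₀ * τ₀⁻¹) * f * (F τ₀ * a₀ * τ₀⁻¹)⁻¹ := by
      intro f
      have h := key x₀ x₀ f _ _ (hidx x₀) (hidx x₀)
      have e1 : FundamentalGroup.fromArrow (τ (idx x₀) x₀ ≫ f ≫ inv (τ (idx x₀) x₀)) =
          τ₀⁻¹ * f * τ₀ := by
        rw [End.mul_def, End.mul_def, ← Groupoid.inv_eq_inv]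
        rfl
      rw [e1, map_mul, map_mul, map_inv] at h
      calc F f = F τ₀ * ((F τ₀)⁻¹ * F f * F τ₀) * (F τ₀)⁻¹ := by group
        _ = _ := by rw [h]; simp only [a₀]; group
    rw [show (F : FundamentalGroup X x₀ → FundamentalGroup X x₀) =
      MulAut.conj (F τ₀ * a₀ * τ₀⁻¹) from funext conj]
    exact MulEquiv.bijective _
  · intro G _ e' he'
    obtain ⟨Φ, hΦ, hs⟩ := he'.exists_functor hU.isOpen idx hidx
    -- The factor converts from the preferred chart at the point to chart `i`, where transport
    -- inside `U i` is trivial. The resulting constant is the inverse of the coboundary term at `i`.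
    have const : ∀ i x y, x ∈ U i → y ∈ U i →
        (e' i (idx x))⁻¹ * Φ _ _ (τ i x) = (e' i (idx y))⁻¹ * Φ _ _ (τ i y) := by
      intro i x y hx hy
      obtain ⟨γ, hγ⟩ := (hU.isPathConnected i).joinedIn _ hx _ hy
      have h1 : e' (idx x) i * e' i (idx x) = 1 := by
        rw [he' _ _ _ ⟨x, ⟨hx, hidx x⟩, hx⟩, he'.self hx]
      rw [← hτ i x y γ hγ, hΦ, hs i x y γ hγ, eq_inv_of_mul_eq_one_left h1]
      group
    let F : FundamentalGroup X x₀ →* G := MonoidHom.mk' (fun f => Φ x₀ x₀ f) fun f g =>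
      hΦ x₀ x₀ x₀ g f
    choose c hc _ using hU.isPathConnected
    refine ⟨F, fun i => ((e' i (idx (c i)))⁻¹ * Φ _ _ (τ i (c i)))⁻¹, ?_⟩
    rintro i j ⟨x, hi, hj⟩
    beta_reduce
    rw [const i _ x (hc i) hi, const j _ x (hc j) hj]
    have h1 : Φ _ _ (τ i x) = Φ _ _ (τ j x) * F (e i j) := by
      rw [he i j x ⟨hi, hj⟩]
      refine Eq.trans ?_ (hΦ _ _ _ _ _)
      simp
    have h2 := he' i j (idx x) ⟨x, ⟨hi, hj⟩, hidx x⟩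
    rw [h1, ← h2]
    group

/-- Path connected spaces that have good covers with the same nonempty triple intersections have
isomorphic fundamental groups. -/
theorem nonempty_mulEquiv {Y : Type*} [TopologicalSpace Y] [PathConnectedSpace X]
    [PathConnectedSpace Y] {U' : ι → Set Y} (hU : IsGoodCover U) (hU' : IsGoodCover U')
    (h : ∀ i j k, (U i ∩ U j ∩ U k).Nonempty ↔ (U' i ∩ U' j ∩ U' k).Nonempty) (x : X) (y : Y) :
    Nonempty (FundamentalGroup X x ≃* FundamentalGroup Y y) := by
  have h2 : ∀ i j, (U i ∩ U j).Nonempty ↔ (U' i ∩ U' j).Nonempty := fun i j => by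
    simpa [inter_assoc] using h i j j
  obtain ⟨e, he, hu, hex⟩ := hU.exists_cocycle x
  obtain ⟨e', he', hu', hex'⟩ := hU'.exists_cocycle y
  obtain ⟨f, a, hf⟩ := hex _ e' fun i j k hi => he' i j k ((h i j k).1 hi)
  obtain ⟨g, b, hg⟩ := hex' _ e fun i j k hi => he i j k ((h i j k).2 hi)
  have hgf := hu (g.comp f) (fun i => g (a i) * b i) fun i j hij => by
    simp only [MonoidHom.comp_apply, hf i j hij, map_mul, hg i j ((h2 i j).1 hij), map_inv]
    group
  have hfg := hu' (f.comp g) (fun i => f (b i) * a i) fun i j hij => by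
    simp only [MonoidHom.comp_apply, hg i j hij, map_mul, hf i j ((h2 i j).2 hij), map_inv]
    group
  exact ⟨MulEquiv.ofBijective f ⟨Function.Injective.of_comp (f := g) hgf.1,
    Function.Surjective.of_comp (g := g) hfg.2⟩⟩

/-- Path connectedness passes to a space covered by path connected sets that intersect whenever
the corresponding members of a cover of a connected space do. -/
theorem pathConnectedSpace_of_inter {Y : Type*} [TopologicalSpace Y] [ConnectedSpace X]
    {U' : ι → Set Y} (hU : ∀ i, IsOpen (U i)) (hcov : ∀ x, ∃ i, x ∈ U i)
    (hne : ∀ i, (U i).Nonempty)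
    (hU' : ∀ i, IsPathConnected (U' i)) (hcov' : ∀ y, ∃ i, y ∈ U' i)
    (h : ∀ i j, (U i ∩ U j).Nonempty → (U' i ∩ U' j).Nonempty) : PathConnectedSpace Y := by
  choose c hc hσ using hU'
  have meet : ∀ i j, (U i ∩ U j).Nonempty → Joined (c i) (c j) := by
    intro i j hij
    obtain ⟨y, hi, hj⟩ := h i j hij
    exact (hσ i hi).joined.trans (hσ j hj).joined.symm
  obtain ⟨x₀⟩ := (inferInstance : Nonempty X)
  obtain ⟨i₀, hi₀⟩ := hcov x₀
  -- By `meet`, members whose base points are joined to `c i₀` never meet the others, so both unions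
  -- are open and complementary.
  let A : Set X := ⋃ i ∈ {i | Joined (c i₀) (c i)}, U i
  have hA : IsClopen A := by
    refine ⟨⟨?_⟩, isOpen_biUnion fun i _ => hU i⟩
    have : Aᶜ = ⋃ i ∈ {i | ¬ Joined (c i₀) (c i)}, U i := by
      ext x
      simp only [A, mem_compl_iff, mem_iUnion, mem_ofPred_eq, exists_prop, not_exists, not_and]
      refine ⟨fun hx => ?_, ?_⟩
      · obtain ⟨i, hi⟩ := hcov x
        exact ⟨i, fun hj => hx i hj hi, hi⟩
      · rintro ⟨i, hi, hxi⟩ j hj hxj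
        exact hi (hj.trans (meet j i ⟨x, hxj, hxi⟩))
    rw [this]
    exact isOpen_biUnion fun i _ => hU i
  have hA' : A = univ := hA.eq_univ ⟨x₀, mem_biUnion (Joined.refl _) hi₀⟩
  have all : ∀ i, Joined (c i₀) (c i) := by
    intro i
    obtain ⟨x, hx⟩ := hne i
    have : x ∈ A := hA' ▸ trivial
    simp only [A, mem_iUnion, mem_ofPred_eq, exists_prop] at this
    obtain ⟨j, hj, hxj⟩ := this
    exact hj.trans (meet j i ⟨x, hxj, hx⟩)
  have all' : ∀ y, Joined (c i₀) y := by
    intro y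
    obtain ⟨i, hi⟩ := hcov' y
    exact (all i).trans (hσ i hi).joined
  exact ⟨⟨c i₀⟩, fun y z => (all' y).symm.trans (all' z)⟩

end IsGoodCover

/-! ### Stars in the realization of a complex -/

section Star

theorem mem_faces_of_subset {V : Type*} {K : PreAbstractSimplicialComplex V} {s t : Finset V} (hs : s ∈ K.faces) (hts : t ⊆ s)
    (ht : t.Nonempty) : t ∈ K.faces :=
  (K.isRelLowerSet_faces hs).2 hts ht

variable {V : Type*} [Fintype V] {K : PreAbstractSimplicialComplex V}

theorem Realization.nonneg (x : Realization K) (v : V) : 0 ≤ x.1 v := x.2.1.1 v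

theorem Realization.exists_face (x : Realization K) : ∃ s ∈ K.faces, ∀ v, v ∈ s ↔ x.1 v ≠ 0 := x.2.2

/-- The point of the realization with given barycentric coordinates. -/
def Realization.ofMem (x : V → ℝ) (hx : x ∈ stdSimplex ℝ V)
    (h : ∃ s ∈ K.faces, ∀ v, x v ≠ 0 → v ∈ s) : Realization K :=
  ⟨x, hx, by
    classical
    obtain ⟨s, hs, hxs⟩ := h
    refine ⟨Finset.univ.filter (x · ≠ 0), mem_faces_of_subset hs (fun v hv => ?_) ?_, by simp⟩
    · exact hxs v (by simpa using hv)
    · obtain ⟨v, -, hv⟩ := Finset.exists_ne_zero_of_sum_ne_zero (hx.2.trans_ne one_ne_zero)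
      exact ⟨v, by simpa using hv⟩⟩

theorem Realization.continuous_ofMem {T : Type*} [TopologicalSpace T] {f : T → V → ℝ}
    (hf : Continuous f) (h₁ : ∀ t, f t ∈ stdSimplex ℝ V)
    (h₂ : ∀ t, ∃ s ∈ K.faces, ∀ v, f t v ≠ 0 → v ∈ s) :
    Continuous fun t => Realization.ofMem (K := K) (f t) (h₁ t) (h₂ t) :=
  hf.subtype_mk _

theorem combo_mem_stdSimplex {x y : V → ℝ} (hx : x ∈ stdSimplex ℝ V) (hy : y ∈ stdSimplex ℝ V)
    (t : I) : (fun v => (1 - (t : ℝ)) * x v + t * y v) ∈ stdSimplex ℝ V :=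
  convex_stdSimplex ℝ V hx hy (by linarith [t.2.2]) t.2.1 (by ring)

/-- The straight segment between two points of a closed simplex. -/
def segment {s : Finset V} (hs : s ∈ K.faces) {x y : Realization K} (hx : x ∈ closedSimplex K s)
    (hy : y ∈ closedSimplex K s) : Path x y where
  toFun t := Realization.ofMem (fun v => (1 - (t : ℝ)) * x.1 v + t * y.1 v)
    (combo_mem_stdSimplex x.2.1 y.2.1 t) ⟨s, hs, fun v hv => by
      by_contra h
      have h1 : x.1 v = 0 := by
        by_contra h1
        exact h (hx v h1)
      have h2 : y.1 v = 0 := by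
        by_contra h2
        exact h (hy v h2)
      simp [h1, h2] at hv⟩
  continuous_toFun := Realization.continuous_ofMem (by fun_prop) _ _
  source' := Subtype.ext (by simp [Realization.ofMem])
  target' := Subtype.ext (by simp [Realization.ofMem])

theorem segment_apply {s : Finset V} (hs : s ∈ K.faces) {x y : Realization K}
    (hx : x ∈ closedSimplex K s) (hy : y ∈ closedSimplex K s) (t : I) (v : V) :
    (segment hs hx hy t).1 v = (1 - (t : ℝ)) * x.1 v + t * y.1 v := rfl

theorem segment_mem_closedSimplex {s : Finset V} (hs : s ∈ K.faces) {x y : Realization K}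
    (hx : x ∈ closedSimplex K s) (hy : y ∈ closedSimplex K s) (t : I) :
    segment hs hx hy t ∈ closedSimplex K s := by
  intro v hv
  by_contra h
  have h1 : x.1 v = 0 := by
    by_contra h1
    exact h (hx v h1)
  have h2 : y.1 v = 0 := by
    by_contra h2
    exact h (hy v h2)
  exact hv (by rw [segment_apply, h1, h2]; simp)

/-- The open star of a point: the union of the relative interiors of the simplices that contain
the point. -/
def openStar (z : Realization K) : Set (Realization K) :=
  {w | ∀ v, z.1 v ≠ 0 → w.1 v ≠ 0}

theorem mem_openStar_self (z : Realization K) : z ∈ openStar z := fun _ h => h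

theorem continuous_coord (v : V) : Continuous fun x : Realization K => x.1 v :=
  (continuous_apply v).comp continuous_subtype_val

theorem isOpen_openStar (z : Realization K) : IsOpen (openStar z) := by
  have : openStar z = ⋂ v ∈ {v | z.1 v ≠ 0}, {w : Realization K | w.1 v ≠ 0} := by
    ext w
    simp [openStar]
  rw [this]
  exact (toFinite _).isOpen_biInter fun v _ => isOpen_ne_fun (continuous_coord v) continuous_const

theorem exists_face_of_mem_openStar {z w : Realization K} (hw : w ∈ openStar z) :
    ∃ s ∈ K.faces, z ∈ closedSimplex K s ∧ w ∈ closedSimplex K s := by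
  obtain ⟨s, hs, h⟩ := w.exists_face
  exact ⟨s, hs, fun v hv => (h v).2 (hw v hv), fun v hv => (h v).2 hv⟩

theorem combo_ne_zero {z w : Realization K} (hw : w ∈ openStar z) (t : I) {v : V}
    (hv : z.1 v ≠ 0) : (1 - (t : ℝ)) * w.1 v + t * z.1 v ≠ 0 := by
  have h1 : 0 < z.1 v := lt_of_le_of_ne (z.nonneg v) hv.symm
  have h2 : 0 < w.1 v := lt_of_le_of_ne (w.nonneg v) (hw v hv).symm
  have h3 : 0 ≤ 1 - (t : ℝ) := by linarith [t.2.2]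
  rcases h3.eq_or_lt with h | h
  · have : (t : ℝ) = 1 := by linarith
    simp [this, hv]
  · have := mul_pos h h2
    have := mul_nonneg t.2.1 h1.le
    linarith

theorem segment_mem_openStar {s : Finset V} (hs : s ∈ K.faces) {z w : Realization K}
    (hw : w ∈ closedSimplex K s) (hz : z ∈ closedSimplex K s) (h : w ∈ openStar z) (t : I) :
    segment hs hw hz t ∈ openStar z :=
  fun _ hv => combo_ne_zero h t hv

/-- The simplex carrying a point of the star contains the simplex carrying `z`, so the linear
contraction to `z` stays in the complex. -/
instance contractibleSpace_openStar (z : Realization K) : ContractibleSpace (openStar z) := by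
  rw [contractible_iff_id_nullhomotopic]
  have hc : ∀ p : I × openStar z, ∃ s ∈ K.faces, ∀ v,
      (1 - (p.1 : ℝ)) * p.2.1.1 v + p.1 * z.1 v ≠ 0 → v ∈ s := by
    intro p
    obtain ⟨s, hs, h⟩ := p.2.1.exists_face
    refine ⟨s, hs, fun v hv => (h v).2 fun h0 => hv ?_⟩
    have : z.1 v = 0 := by
      by_contra h1
      exact p.2.2 v h1 h0
    simp [this, h0]
  refine ⟨⟨z, mem_openStar_self z⟩, ⟨?_⟩⟩
  exact
    { toFun := fun p => ⟨Realization.ofMem (fun v => (1 - (p.1 : ℝ)) * p.2.1.1 v + p.1 * z.1 v)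
        (combo_mem_stdSimplex p.2.1.2.1 z.2.1 p.1) (hc p), fun v hv => combo_ne_zero p.2.2 p.1 hv⟩
      continuous_toFun := by
        refine Continuous.subtype_mk (Realization.continuous_ofMem ?_ _ _) _
        refine continuous_pi fun v => ?_
        have h1 : Continuous fun p : I × openStar z => p.2.1.1 v :=
          (continuous_coord v).comp (continuous_subtype_val.comp continuous_snd)
        fun_prop
      map_zero_left := fun w => Subtype.ext (Subtype.ext (by simp [Realization.ofMem]))
      map_one_left := fun w => Subtype.ext (Subtype.ext (by simp [Realization.ofMem])) }

theorem isPathConnected_openStar (z : Realization K) : IsPathConnected (openStar z) :=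
  isPathConnected_iff_pathConnectedSpace.2 inferInstance

theorem homotopic_of_mem_openStar {z x y : Realization K} (α β : Path x y)
    (hα : ∀ t, α t ∈ openStar z) (hβ : ∀ t, β t ∈ openStar z) : α.Homotopic β := by
  have hx : x ∈ openStar z := by simpa using hα 0
  have hy : y ∈ openStar z := by simpa using hα 1
  let lift : ∀ γ : Path x y, (∀ t, γ t ∈ openStar z) →
      Path (⟨x, hx⟩ : openStar z) ⟨y, hy⟩ := fun γ hγ =>
    { toFun := fun t => ⟨γ t, hγ t⟩
      continuous_toFun := γ.continuous.subtype_mk _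
      source' := Subtype.ext γ.source
      target' := Subtype.ext γ.target }
  exact (SimplyConnectedSpace.paths_homotopic (lift α hα) (lift β hβ)).map
    ⟨Subtype.val, continuous_subtype_val⟩

open Classical in
/-- The barycentre of a simplex. -/
noncomputable def barycentre {s : Finset V} (hs : s ∈ K.faces) : Realization K :=
  Realization.ofMem (fun v => if v ∈ s then (s.card : ℝ)⁻¹ else 0)
    ⟨fun v => by positivity, by
      have : (s.card : ℝ) ≠ 0 := by
        exact_mod_cast (Finset.card_pos.2 (K.isRelLowerSet_faces hs).1).ne'
      simp [this]⟩
    ⟨s, hs, fun v hv => by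
      by_contra h
      simp [h] at hv⟩

theorem barycentre_ne_zero_iff {s : Finset V} (hs : s ∈ K.faces) (v : V) :
    (barycentre hs).1 v ≠ 0 ↔ v ∈ s := by
  have : (s.card : ℝ) ≠ 0 := by
    exact_mod_cast (Finset.card_pos.2 (K.isRelLowerSet_faces hs).1).ne'
  by_cases h : v ∈ s <;> simp [barycentre, Realization.ofMem, h, this]

theorem openStar_barycentre {s : Finset V} (hs : s ∈ K.faces) :
    openStar (barycentre hs) = {x | ∀ v ∈ s, x.1 v ≠ 0} := by
  ext x
  simp only [openStar, barycentre_ne_zero_iff]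

/-- The open stars of the vertices. -/
def vertexStar (K : PreAbstractSimplicialComplex V) (v : V) : Set (Realization K) :=
  {x | x.1 v ≠ 0}

theorem vertexStar_eq {v : V} (hv : {v} ∈ K.faces) : vertexStar K v = openStar (barycentre hv) := by
  rw [openStar_barycentre]
  simp [vertexStar]

theorem exists_mem_vertexStar (x : Realization K) : ∃ v, x ∈ vertexStar K v := by
  obtain ⟨v, -, hv⟩ := Finset.exists_ne_zero_of_sum_ne_zero (x.2.1.2.trans_ne one_ne_zero)
  exact ⟨v, hv⟩

-- Repetitions among `i`, `j`, `k` are allowed, so pairs and single vertices are covered too.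
open Classical in
theorem vertexStar_inter_nonempty_iff (i j k : V) :
    (vertexStar K i ∩ vertexStar K j ∩ vertexStar K k).Nonempty ↔ {i, j, k} ∈ K.faces := by
  constructor
  · rintro ⟨x, ⟨hi, hj⟩, hk⟩
    obtain ⟨s, hs, h⟩ := x.exists_face
    refine mem_faces_of_subset hs (fun v hv => (h v).2 ?_) (by simp)
    simp only [Finset.mem_insert, Finset.mem_singleton] at hv
    rcases hv with rfl | rfl | rfl <;> assumption
  · intro h
    exact ⟨barycentre h, ⟨(barycentre_ne_zero_iff h i).2 (by simp),
      (barycentre_ne_zero_iff h j).2 (by simp)⟩, (barycentre_ne_zero_iff h k).2 (by simp)⟩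

/-- The open stars of the vertices form a good cover of the realization. -/
theorem isGoodCover_vertexStar (hK : ∀ v, {v} ∈ K.faces) : IsGoodCover (vertexStar K) where
  isOpen v := by
    rw [vertexStar_eq (hK v)]
    exact isOpen_openStar _
  exists_mem := exists_mem_vertexStar
  isPathConnected v := by
    rw [vertexStar_eq (hK v)]
    exact isPathConnected_openStar _
  homotopic i j x y α β hα hβ := by
    classical
    have hxi : x ∈ vertexStar K i := by simpa using hα 0
    have hxj : x ∈ vertexStar K j := by simpa using hβ 0
    have hyi : y ∈ vertexStar K i := by simpa using hα 1
    have hyj : y ∈ vertexStar K j := by simpa using hβ 1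
    have hij : {i, j} ∈ K.faces := by
      simpa using (vertexStar_inter_nonempty_iff i j j).1 ⟨x, ⟨hxi, hxj⟩, hxj⟩
    have hmem : ∀ z, z ∈ openStar (barycentre hij) ↔ z ∈ vertexStar K i ∧ z ∈ vertexStar K j := by
      intro z
      rw [openStar_barycentre]
      simp [vertexStar]
    -- The two vertex stars intersect in the star of the edge; a path there compares with `α` in one
    -- star and with `β` in the other.
    obtain ⟨γ, hγ⟩ := (isPathConnected_openStar (barycentre hij)).joinedIn _
      ((hmem x).2 ⟨hxi, hxj⟩) _ ((hmem y).2 ⟨hyi, hyj⟩)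
    rw [vertexStar_eq (hK i)] at hα
    rw [vertexStar_eq (hK j)] at hβ
    refine (homotopic_of_mem_openStar (z := barycentre (hK i)) α γ hα fun t => ?_).trans
      (homotopic_of_mem_openStar (z := barycentre (hK j)) γ β (fun t => ?_) hβ)
    · rw [← vertexStar_eq]
      exact ((hmem _).1 (hγ t)).1
    · rw [← vertexStar_eq]
      exact ((hmem _).1 (hγ t)).2

end Star

/-! ### Lengths of paths and balls of a piecewise flat metric -/

namespace PiecewiseFlatMetric

variable {V : Type*} [Fintype V] {K : PreAbstractSimplicialComplex V} (G : PiecewiseFlatMetric K)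

theorem intrinsicDist_le_length {x y : Realization K} (γ : Path x y) (t : I) :
    G.intrinsicDist x (γ t) ≤ G.length γ := by
  let _ := G.toPseudoEMetricSpace
  have := eVariationOn.edist_le (γ : I → Realization K) (mem_univ 0) (mem_univ t)
  rw [γ.source] at this
  exact this

theorem length_symm_le {x y : Realization K} (γ : Path x y) : G.length γ.symm ≤ G.length γ := by
  let _ := G.toPseudoEMetricSpace
  exact eVariationOn.comp_le_of_antitoneOn (γ : I → Realization K) (s := univ) (t := univ) σ
    (fun a _ b _ h => unitInterval.symm_le_symm.2 h) (mapsTo_univ _ _)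

theorem length_trans_le {x y z : Realization K} (γ : Path x y) (δ : Path y z) :
    G.length (γ.trans δ) ≤ G.length γ + G.length δ := by
  let _ := G.toPseudoEMetricSpace
  let h : I := ⟨1 / 2, by norm_num, by norm_num⟩
  have split := eVariationOn.Icc_add_Icc (γ.trans δ : I → Realization K) (s := univ)
    (show 0 ≤ h from bot_le) (show h ≤ 1 from le_top) (mem_univ _)
  simp only [univ_inter] at split
  have e : (univ : Set I) = Icc 0 1 := Set.Icc_bot_top.symm
  have h1 : eVariationOn (γ.trans δ : I → Realization K) (Icc 0 h) ≤ G.length γ := by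
    rw [eVariationOn.congr (g := γ ∘ fun t : I => projIcc (0 : ℝ) 1 zero_le_one (2 * t))]
    · refine eVariationOn.comp_le_of_monotoneOn (γ : I → Realization K) _
        (fun a _ b _ hab => monotone_projIcc _ ?_) (mapsTo_univ _ _)
      have : (a : ℝ) ≤ b := hab
      linarith
    · intro t ht
      have : (t : ℝ) ≤ 1 / 2 := ht.2
      rw [Path.trans_apply, dif_pos this]
      simp only [Function.comp]
      rw [projIcc_of_mem]
  have h2 : eVariationOn (γ.trans δ : I → Realization K) (Icc h 1) ≤ G.length δ := by
    rw [eVariationOn.congr (g := δ ∘ fun t : I => projIcc (0 : ℝ) 1 zero_le_one (2 * t - 1))]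
    · refine eVariationOn.comp_le_of_monotoneOn (δ : I → Realization K) _
        (fun a _ b _ hab => monotone_projIcc _ ?_) (mapsTo_univ _ _)
      have : (a : ℝ) ≤ b := hab
      linarith
    · intro t ht
      have : (1 / 2 : ℝ) ≤ t := ht.1
      rw [Path.trans_apply]
      simp only [Function.comp]
      split_ifs with h'
      · have : (t : ℝ) = 1 / 2 := le_antisymm h' this
        simp [this]
      · rw [projIcc_of_mem]
  calc G.length (γ.trans δ) = eVariationOn (γ.trans δ : I → Realization K) (Icc 0 1) := by
        rw [← e]
        rfl
    _ ≤ _ := by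
      rw [← split]
      exact add_le_add h1 h2

theorem intrinsicDist_le_edist_chart {s : Finset V} (hs : s ∈ K.faces) {x y : Realization K}
    (hx : x ∈ closedSimplex K s) (hy : y ∈ closedSimplex K s) :
    G.intrinsicDist x y ≤ edist (G.chart s x) (G.chart s y) := by
  have := G.intrinsicDist_le 1 (fun i => if i = 0 then x else y)
  simp only [Finset.sum_range_one, if_true, zero_add, one_ne_zero, if_false] at this
  exact this.trans (iInf₂_le s ⟨hs, hx, hy⟩)

theorem chart_segment {s : Finset V} (hs : s ∈ K.faces) {x y : Realization K}
    (hx : x ∈ closedSimplex K s) (hy : y ∈ closedSimplex K s) (t : I) :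
    G.chart s (segment hs hx hy t) = (1 - (t : ℝ)) • G.chart s x + (t : ℝ) • G.chart s y := by
  simp only [chart, Finset.smul_sum, ← Finset.sum_add_distrib, segment_apply, add_smul, mul_smul]

/-- The segment has constant speed in the chart, and chart distance bounds intrinsic distance, so it
is Lipschitz with the chart distance of its endpoints as constant. -/
theorem length_segment_le {s : Finset V} (hs : s ∈ K.faces) {x y : Realization K}
    (hx : x ∈ closedSimplex K s) (hy : y ∈ closedSimplex K s) :
    G.length (segment hs hx hy) ≤ edist (G.chart s x) (G.chart s y) := by
  let _ := G.toPseudoEMetricSpace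
  let γ := segment hs hx hy
  have lip : LipschitzOnWith (nndist (G.chart s x) (G.chart s y)) γ.extend (Icc 0 1) := by
    intro a ha b hb
    rw [Path.extend_apply _ ha, Path.extend_apply _ hb]
    refine (G.intrinsicDist_le_edist_chart hs (segment_mem_closedSimplex hs hx hy _)
      (segment_mem_closedSimplex hs hx hy _)).trans (le_of_eq ?_)
    rw [chart_segment, chart_segment, edist_dist, edist_dist, ← ENNReal.ofReal_coe_nnreal,
      ← ENNReal.ofReal_mul (by positivity), coe_nndist, dist_eq_norm, dist_eq_norm, dist_eq_norm,
      show (1 - a) • G.chart s x + a • G.chart s y - ((1 - b) • G.chart s x + b • G.chart s y) =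
        (b - a) • (G.chart s x - G.chart s y) by module, norm_smul, norm_sub_rev b a, mul_comm]
  have h := lip.comp_eVariationOn_le (g := ((↑) : I → ℝ)) (s := univ) (fun t _ => t.2)
  have h1 : eVariationOn ((↑) : I → ℝ) univ ≤ 1 := by
    have := MonotoneOn.eVariationOn_eq (f := ((↑) : I → ℝ)) (s := univ)
      (Subtype.mono_coe _ |>.monotoneOn _) (mem_univ 0) (mem_univ 1)
    have e : (univ : Set I) ∩ Icc 0 1 = univ := (univ_inter _).trans Set.Icc_bot_top
    simpa [e] using this.le
  have e : γ.extend ∘ ((↑) : I → ℝ) = γ := by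
    ext t
    simp
  rw [e] at h
  calc G.length γ ≤ _ := h
    _ ≤ edist (G.chart s x) (G.chart s y) * 1 := by
      rw [edist_nndist]
      gcongr
    _ = _ := mul_one _

/-- Concatenating the segments of a broken line turns intrinsic distance into lengths of actual
paths. -/
theorem iInf_length_le_intrinsicDist (x y : Realization K) :
    ⨅ γ : Path x y, G.length γ ≤ G.intrinsicDist x y := by
  have step : ∀ x y : Realization K, ⨅ γ : Path x y, G.length γ ≤ G.simplexDist x y := fun x y =>
    le_iInf₂ fun s hs => (iInf_le _ _).trans (G.length_segment_le hs.1 hs.2.1 hs.2.2)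
  have refl : ∀ x : Realization K, ⨅ γ : Path x x, G.length γ ≤ 0 := fun x => by
    let _ := G.toPseudoEMetricSpace
    refine (iInf_le _ (Path.refl x)).trans (le_of_eq ?_)
    refine eVariationOn.constant_on ?_
    rintro _ ⟨_, _, rfl⟩ _ ⟨_, _, rfl⟩
    rfl
  have triangle : ∀ x y z : Realization K, ⨅ γ : Path x z, G.length γ ≤
      (⨅ γ : Path x y, G.length γ) + ⨅ γ : Path y z, G.length γ := by
    intro x y z
    simp only [ENNReal.iInf_add, ENNReal.add_iInf]
    exact le_iInf₂ fun γ δ => (iInf_le _ _).trans (G.length_trans_le _ _)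
  have sum : ∀ (z : ℕ → Realization K) n, ⨅ γ : Path (z 0) (z n), G.length γ ≤
      ∑ i ∈ Finset.range n, G.simplexDist (z i) (z (i + 1)) := by
    intro z n
    induction n with
    | zero => simpa using refl (z 0)
    | succ n ih =>
      rw [Finset.sum_range_succ]
      exact (triangle _ _ _).trans (add_le_add ih (step _ _))
  refine le_iInf₂ fun n z => le_iInf₂ fun h0 hn => ?_
  subst h0 hn
  exact sum z n

theorem exists_path_of_intrinsicDist_lt {x y : Realization K} {r : ℝ≥0∞}
    (h : G.intrinsicDist x y < r) : ∃ γ : Path x y, G.length γ < r :=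
  iInf_lt_iff.1 ((G.iInf_length_le_intrinsicDist x y).trans_lt h)

theorem mem_openBall_of_length_lt {x y : Realization K} {r : ℝ≥0∞} {γ : Path x y}
    (h : G.length γ < r) (t : I) : γ t ∈ G.openBall x r :=
  (G.intrinsicDist_le_length γ t).trans_lt h

/-- Every point has a small neighbourhood in its open star, whose points are joined to it by short
segments. -/
theorem exists_nhd_short_segments (z : Realization K) {r : ℝ≥0∞} (hr : 0 < r) :
    ∃ W : Set (Realization K), IsOpen W ∧ z ∈ W ∧ W ⊆ openStar z ∧
      ∀ w ∈ W, ∃ γ : Path w z, (∀ t, γ t ∈ openStar z) ∧ G.length γ < r := by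
  -- `M` dominates the vertex positions in all charts at once, so the continuous function `φ` bounds
  -- the distance to `z` in whichever simplex is used.
  let M : V → ℝ := fun v => ∑ s : Finset V, ‖G.pos s v‖
  let φ : Realization K → ℝ := fun w => ∑ v, |w.1 v - z.1 v| * M v
  have hφ : Continuous φ := continuous_finsetSum _ fun v _ =>
    (((continuous_coord v).sub continuous_const).abs).mul continuous_const
  have hle : ∀ s w, w ∈ closedSimplex K s → z ∈ closedSimplex K s →
      edist (G.chart s w) (G.chart s z) ≤ ENNReal.ofReal (φ w) := by
    intro s w _ _
    rw [edist_dist, dist_eq_norm]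
    refine ENNReal.ofReal_le_ofReal ?_
    simp only [chart, ← Finset.sum_sub_distrib, ← sub_smul]
    refine (norm_sum_le _ _).trans ?_
    have hM : ∀ v, 0 ≤ M v := fun v => Finset.sum_nonneg fun _ _ => norm_nonneg _
    calc ∑ v ∈ s, ‖(w.1 v - z.1 v) • G.pos s v‖ ≤ ∑ v ∈ s, |w.1 v - z.1 v| * M v := by
          refine Finset.sum_le_sum fun v _ => ?_
          rw [norm_smul, Real.norm_eq_abs]
          exact mul_le_mul_of_nonneg_left (Finset.single_le_sum
            (f := fun s => ‖G.pos s v‖) (fun _ _ => norm_nonneg _) (Finset.mem_univ s))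
            (abs_nonneg _)
      _ ≤ φ w := Finset.sum_le_sum_of_subset_of_nonneg (Finset.subset_univ _)
          fun v _ _ => mul_nonneg (abs_nonneg _) (hM v)
  refine ⟨openStar z ∩ {w | ENNReal.ofReal (φ w) < r}, (isOpen_openStar z).inter
    (isOpen_lt (ENNReal.continuous_ofReal.comp hφ) continuous_const),
    ⟨mem_openStar_self z, by simpa [φ] using hr⟩, inter_subset_left, ?_⟩
  rintro w ⟨hw, hwr⟩
  obtain ⟨s, hs, hzs, hws⟩ := exists_face_of_mem_openStar hw
  exact ⟨segment hs hws hzs, segment_mem_openStar hs hws hzs hw,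
    (G.length_segment_le hs hws hzs).trans_lt ((hle s w hws hzs).trans_lt hwr)⟩

/-- The topology is that of $\mathbb R^V$, not the metric one, so openness comes from neighbourhoods
with segments shorter than the slack `r - G.intrinsicDist c y`. -/
theorem isOpen_openBall (c : Realization K) (r : ℝ≥0∞) : IsOpen (G.openBall c r) := by
  refine isOpen_iff_forall_mem_open.2 fun y hy => ?_
  obtain ⟨W, hW, hyW, -, h⟩ := G.exists_nhd_short_segments y (tsub_pos_of_lt hy)
  refine ⟨W, fun w hw => ?_, hW, hyW⟩
  obtain ⟨γ, -, hγ⟩ := h w hw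
  have h1 : G.intrinsicDist y w < r - G.intrinsicDist c y := by
    rw [intrinsicDist_comm]
    have := G.intrinsicDist_le_length γ 1
    rw [γ.target] at this
    exact this.trans_lt hγ
  exact (G.intrinsicDist_triangle c y w).trans_lt (lt_tsub_iff_left.1 h1)

theorem isPathConnected_openBall (c : Realization K) {r : ℝ≥0∞} (hr : 0 < r) :
    IsPathConnected (G.openBall c r) := by
  refine ⟨c, by simpa [openBall, G.intrinsicDist_self] using hr, fun {y} hy => ?_⟩
  obtain ⟨γ, hγ⟩ := G.exists_path_of_intrinsicDist_lt hy
  exact ⟨γ, G.mem_openBall_of_length_lt hγ⟩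

/-- Two paths whose total length is less than the systole are homotopic. -/
theorem homotopic_of_length_add_lt {x y : Realization K} (p q : Path x y)
    (h : G.length p + G.length q < G.systole) : p.Homotopic q := by
  have h1 : G.length (p.trans q.symm) < G.systole :=
    ((G.length_trans_le _ _).trans (add_le_add le_rfl (G.length_symm_le q))).trans_lt h
  have h2 : (p.trans q.symm).Homotopic (Path.refl x) := by
    by_contra hne
    exact absurd h1 (not_lt.2 (iInf₂_le_of_le x (p.trans q.symm) (iInf_le _ hne)))
  rw [← pathHom_eq_iff, pathHom_trans, pathHom_symm, pathHom_refl, Groupoid.inv_eq_inv] at h2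
  exact pathHom_eq_iff.1 (by simpa using (IsIso.comp_inv_eq _).1 h2)

variable {G} {R : ℝ≥0∞}

theorem homotopic_of_length_lt (hsys : R + R + (R + R) ≤ G.systole) {x y z w : Realization K}
    {p : Path x z} {q : Path z y} {p' : Path x w} {q' : Path w y} (hp : G.length p < R)
    (hq : G.length q < R) (hp' : G.length p' < R) (hq' : G.length q' < R) :
    (p.trans q).Homotopic (p'.trans q') :=
  G.homotopic_of_length_add_lt _ _ <| lt_of_lt_of_le
    (ENNReal.add_lt_add ((G.length_trans_le _ _).trans_lt (ENNReal.add_lt_add hp hq))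
      ((G.length_trans_le _ _).trans_lt (ENNReal.add_lt_add hp' hq'))) hsys

/-- A path in a ball whose radius is small with respect to the systole is homotopic to any short
path through the centre. -/
theorem pathHom_comp_of_mem_openBall (hsys : R + R + (R + R) ≤ G.systole) (hR : 0 < R)
    {c x y : Realization K} (α : Path x y) (hα : ∀ t, α t ∈ G.openBall c R)
    (p : Path c x) (q : Path c y) (hp : G.length p < R) (hq : G.length q < R) :
    pathHom p ≫ pathHom α = pathHom q := by
  choose W hW hzW hWz hWγ using fun z => G.exists_nhd_short_segments z hR
  -- Quantifying over all short `p` and `q` lets the induction insert a short path from `c` to each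
  -- division point, which lies in the ball.
  refine pathHom_induction (S := G.openBall c R) (W := W)
    (P := fun x y f => ∀ (p : Path c x) (q : Path c y), G.length p < R → G.length q < R →
      pathHom p ≫ f = pathHom q) hW (fun z _ => mem_iUnion.2 ⟨z, hzW z⟩) ?_ ?_ α hα p q hp hq
  · intro z x y γ _ hγ p q hp hq
    obtain ⟨δ, hδ, hδR⟩ := hWγ z x (by simpa using hγ 0)
    obtain ⟨ε, hε, hεR⟩ := hWγ z y (by simpa using hγ 1)
    have h1 : pathHom γ = pathHom δ ≫ pathHom ε.symm := by
      rw [← pathHom_trans, pathHom_eq_iff]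
      refine homotopic_of_mem_openStar (z := z) _ _ (fun t => hWz z (hγ t)) fun t => ?_
      have : δ.trans ε.symm t ∈ range δ ∪ range ε.symm := by
        rw [← Path.trans_range]
        exact ⟨t, rfl⟩
      rcases this with ⟨s, hs⟩ | ⟨s, hs⟩
      · exact hs ▸ hδ s
      · exact hs ▸ hε _
    -- Two routes from `c` to `z`, with four legs shorter than `R` in all.
    have h2 : pathHom p ≫ pathHom δ = pathHom q ≫ pathHom ε :=
      pathHom_eq_iff.2 (homotopic_of_length_lt hsys hp hδR hq hεR)
    rw [h1, pathHom_symm, Groupoid.inv_eq_inv, reassoc_of% h2]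
    simp
  · intro x y z f g hy hf hg p q hp hq
    obtain ⟨r, hr⟩ := G.exists_path_of_intrinsicDist_lt hy
    rw [← Category.assoc, hf p r hp hr, hg r q hr hq]

/-- Balls whose radius is small with respect to the systole form a good cover. -/
theorem isGoodCover_openBall {ι : Type*} (hsys : R + R + (R + R) ≤ G.systole) (hR : 0 < R)
    (c : ι → Realization K) (hc : ∀ x, ∃ i, x ∈ G.openBall (c i) R) :
    IsGoodCover fun i => G.openBall (c i) R where
  isOpen i := G.isOpen_openBall _ _
  exists_mem := hc
  isPathConnected i := G.isPathConnected_openBall _ hR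
  homotopic i j x y α β hα hβ := by
    have hxi : x ∈ G.openBall (c i) R := by simpa using hα 0
    have hxj : x ∈ G.openBall (c j) R := by simpa using hβ 0
    have hyi : y ∈ G.openBall (c i) R := by simpa using hα 1
    have hyj : y ∈ G.openBall (c j) R := by simpa using hβ 1
    obtain ⟨p, hp⟩ := G.exists_path_of_intrinsicDist_lt hxi
    obtain ⟨q, hq⟩ := G.exists_path_of_intrinsicDist_lt hyi
    obtain ⟨p', hp'⟩ := G.exists_path_of_intrinsicDist_lt hxj
    obtain ⟨q', hq'⟩ := G.exists_path_of_intrinsicDist_lt hyj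
    have h1 := pathHom_comp_of_mem_openBall hsys hR α hα p q hp hq
    have h2 := pathHom_comp_of_mem_openBall hsys hR β hβ p' q' hp' hq'
    have h3 : pathHom p.symm ≫ pathHom q = pathHom p'.symm ≫ pathHom q' :=
      pathHom_eq_iff.2 (homotopic_of_length_lt hsys ((G.length_symm_le p).trans_lt hp) hq
        ((G.length_symm_le p').trans_lt hp') hq')
    rw [← h1, ← h2, pathHom_symm, pathHom_symm, Groupoid.inv_eq_inv, Groupoid.inv_eq_inv,
      IsIso.inv_hom_id_assoc, IsIso.inv_hom_id_assoc] at h3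
    exact pathHom_eq_iff.1 h3

end PiecewiseFlatMetric

/-! ### The nerve -/

open Classical in
theorem mem_nerve_faces_iff {X ι : Type*} (B : ι → Set X) (i j k : ι) :
    {i, j, k} ∈ (nerve B).faces ↔ (B i ∩ B j ∩ B k).Nonempty := by
  simp [nerve, Set.Nonempty, and_assoc]

/-- The two-dimensional skeleton of a complex. -/
def twoSkeleton {V : Type*} (K : PreAbstractSimplicialComplex V) (hK : ∀ v, {v} ∈ K.faces) :
    AbstractSimplicialComplex V where
  faces := {s | s ∈ K.faces ∧ s.card ≤ 3}
  isRelLowerSet_faces := fun _ hs => ⟨(K.isRelLowerSet_faces hs.1).1, fun _ hts ht =>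
    ⟨mem_faces_of_subset hs.1 hts ht, (Finset.card_le_card hts).trans hs.2⟩⟩
  singleton_mem v := ⟨hK v, by simp⟩

/-- Comparing only simplices with at most three vertices makes this apply to both the nerve and its
2-skeleton. -/
theorem IsGoodCover.pathConnectedSpace_and_nonempty_mulEquiv {X ι : Type*} [Fintype ι]
    [TopologicalSpace X] [PathConnectedSpace X] {B : ι → Set X} (hB : IsGoodCover B)
    (N : PreAbstractSimplicialComplex ι) (hN : ∀ i, {i} ∈ N.faces)
    (h : ∀ s : Finset ι, s.card ≤ 3 → (s ∈ N.faces ↔ s ∈ (nerve B).faces)) :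
    PathConnectedSpace (Realization N) ∧ ∀ (x : X) (p : Realization N),
      Nonempty (FundamentalGroup X x ≃* FundamentalGroup _ p) := by
  classical
  have hgood := isGoodCover_vertexStar hN
  have h3 : ∀ i j k, (B i ∩ B j ∩ B k).Nonempty ↔
      (vertexStar N i ∩ vertexStar N j ∩ vertexStar N k).Nonempty := fun i j k => by
    rw [vertexStar_inter_nonempty_iff, h _ Finset.card_le_three, mem_nerve_faces_iff]
  have hpc : PathConnectedSpace (Realization N) :=
    IsGoodCover.pathConnectedSpace_of_inter hB.isOpen hB.exists_mem
      (fun i => (hB.isPathConnected i).nonempty) hgood.isPathConnected hgood.exists_mem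
      fun i j hij => by simpa [inter_assoc] using (h3 i j j).1 (by simpa [inter_assoc] using hij)
  exact ⟨hpc, fun x p => hB.nonempty_mulEquiv hgood h3 x p⟩

end SystolicNerve

open SystolicNerve in
theorem mainTheorem8 {V : Type*} [Fintype V] (K : PreAbstractSimplicialComplex V)
    (hK : PathConnectedSpace (Realization K)) (G : PiecewiseFlatMetric K)
    (m : ℕ) (c : Fin m → Realization K)
    (hcover : ∀ x, ∃ i, x ∈ G.openBall (c i) (G.systole / 6)) :
    (PathConnectedSpace (Realization (nerve fun i => G.openBall (c i) (G.systole / 6))) ∧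
      ∀ (x : Realization K)
        (p : Realization (nerve fun i => G.openBall (c i) (G.systole / 6))),
        Nonempty (FundamentalGroup _ x ≃* FundamentalGroup _ p)) ∧
    ∀ x : Realization K, MemGamma m (FundamentalGroup _ x) := by
  have hR : 0 < G.systole / 6 := by
    obtain ⟨x⟩ := hK.nonempty
    obtain ⟨i, hi⟩ := hcover x
    exact pos_of_gt hi
  -- Only four of the six radii are needed; the computation in `ℝ≥0∞` includes an infinite systole.
  have hsys : G.systole / 6 + G.systole / 6 + (G.systole / 6 + G.systole / 6) ≤ G.systole := by
    calc _ = 4 * (G.systole / 6) := by ring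
      _ ≤ 6 * (G.systole / 6) := by gcongr; norm_num
      _ = G.systole := ENNReal.mul_div_cancel (by norm_num) (by norm_num)
  have hgood := PiecewiseFlatMetric.isGoodCover_openBall hsys hR c hcover
  have hN : ∀ i, {i} ∈ (nerve fun i => G.openBall (c i) (G.systole / 6)).faces := fun i =>
    ⟨by simp, c i, by simpa [PiecewiseFlatMetric.openBall, G.intrinsicDist_self] using hR⟩
  refine ⟨hgood.pathConnectedSpace_and_nonempty_mulEquiv _ hN fun _ _ => Iff.rfl, fun x => ?_⟩
  obtain ⟨hpc, hiso⟩ := hgood.pathConnectedSpace_and_nonempty_mulEquiv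
    (twoSkeleton _ hN).toPreAbstractSimplicialComplex (fun i => (twoSkeleton _ hN).singleton_mem i)
    fun s hs => ⟨fun h => h.1, fun h => ⟨h, hs⟩⟩
  obtain ⟨p⟩ := hpc.nonempty
  exact ⟨m, le_rfl, twoSkeleton _ hN, fun s hs => hs.2, hpc, p, hiso x p⟩
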